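/- Let $\mathbb T=\mathbb R\cup\{-\infty\}$ be the tropical semiring, with addition $\max$ and multiplication the usual $+$ (so its zero element is $-\infty$), and let $\overline{\mathbb T}=\mathbb T\cup\{+\infty\}$ be the completed tropical semiring, where $+\infty$ is absorbing for both operations except that $(-\infty)(+\infty)=(+\infty)(-\infty)=-\infty$. Let $S\in\{\mathbb T,\overline{\mathbb T}\}$ and $n\in\mathbb N$, and let $M_n(S)$ be the monoid of $n\times n$ matrices over $S$ under matrix multiplication. For $A,B\in M_n(S)$ write $A\le_{\mathcal J}B$ if $M_n(S)\,A\,M_n(S)\subseteq M_n(S)\,B\,M_n(S)$, and $A\,\mathcal J\,B$ if these two sets are equal. Vectors $x_1,\dots,x_t\in S^n$ are called Gondran–Minoux independent if, whenever $I,J\subseteq\{1,\dots,t\}$ are disjoint and $\alpha_i\in S$ $(i\in I\cup J)$ satisfy $\sum_{i\in I}\alpha_i x_i=\sum_{j\in J}\alpha_j x_j$, then $\alpha_i$ is the zero element of $S$ for every $i\in I\cup J$. The maximal Gondran–Minoux column rank (respectively row rank) of $A\in M_n(S)$ is the maximal number of Gondran–Minoux independent columns (respectively rows) of $A$. **Corollary.**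 The maximal Gondran–Minoux column rank and the maximal Gondran–Minoux row rank respect the $\mathcal J$-order on $M_n(S)$: if $A\le_{\mathcal J}B$, then each of these two ranks of $A$ is at most the corresponding rank of $B$. Hence both are $\mathcal J$-class invariants: if $A\,\mathcal J\,B$, then $A$ and $B$ have the same maximal Gondran–Minoux column rank and the same maximal Gondran–Minoux row rank. -/

import Mathlib

/-! ### The max-plus semirings -/

/-- Elements of `R`, to be added by `max` and multiplied by the addition of `R`. -/
@[ext]
structure MaxPlus (R : Type*) where
  /-- The element of `R` underlying an element of the max-plus semiring. -/
  val : R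

/-- The bottom element is absorbing for addition. -/
class BotAbsorbing (R : Type*) [Add R] [Bot R] : Prop where
  bot_add' : ∀ x : R, ⊥ + x = ⊥

instance : BotAbsorbing (WithBot ℝ) := ⟨WithBot.bot_add⟩

instance : BotAbsorbing EReal := ⟨EReal.bot_add⟩

namespace MaxPlus

variable {R : Type*}

instance [Bot R] : Zero (MaxPlus R) := ⟨⟨⊥⟩⟩

instance [Zero R] : One (MaxPlus R) := ⟨⟨0⟩⟩

instance [LinearOrder R] : Add (MaxPlus R) := ⟨fun a b => ⟨max a.val b.val⟩⟩

instance [Add R] : Mul (MaxPlus R) := ⟨fun a b => ⟨a.val + b.val⟩⟩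

@[simp] theorem val_zero [Bot R] : (0 : MaxPlus R).val = ⊥ := rfl

@[simp] theorem val_one [Zero R] : (1 : MaxPlus R).val = 0 := rfl

@[simp] theorem val_add [LinearOrder R] (a b : MaxPlus R) : (a + b).val = max a.val b.val := rfl

@[simp] theorem val_mul [Add R] (a b : MaxPlus R) : (a * b).val = a.val + b.val := rfl

instance [LinearOrder R] [OrderBot R] [AddCommMonoid R] [IsOrderedAddMonoid R]
    [BotAbsorbing R] : CommSemiring (MaxPlus R) where
  add_assoc a b c := MaxPlus.ext (max_assoc _ _ _)
  zero_add a := MaxPlus.ext (max_eq_right bot_le)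
  add_zero a := MaxPlus.ext (max_eq_left bot_le)
  add_comm a b := MaxPlus.ext (max_comm _ _)
  mul_assoc a b c := MaxPlus.ext (add_assoc _ _ _)
  one_mul a := MaxPlus.ext (zero_add _)
  mul_one a := MaxPlus.ext (add_zero _)
  mul_comm a b := MaxPlus.ext (add_comm _ _)
  zero_mul a := MaxPlus.ext (BotAbsorbing.bot_add' _)
  mul_zero a := MaxPlus.ext ((add_comm _ _).trans (BotAbsorbing.bot_add' _))
  left_distrib a b c := MaxPlus.ext
    (Monotone.map_max (f := fun x => a.val + x) fun _ _ h => add_le_add_right h a.val)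
  right_distrib a b c := MaxPlus.ext
    (Monotone.map_max (f := fun x => x + c.val) fun _ _ h => add_le_add_left h c.val)
  nsmul := nsmulRec
  npow := npowRec

end MaxPlus

/-- The tropical semiring `ℝ ∪ {-∞}`. -/
abbrev TropicalSemiring : Type := MaxPlus (WithBot ℝ)

/-- The completed tropical semiring `ℝ ∪ {-∞, +∞}`, in which `(-∞) ⊗ (+∞) = -∞`
(this is the convention of addition in `EReal`). -/
abbrev CompletedTropicalSemiring : Type := MaxPlus EReal

/-! ### Green's `J`-preorder and `J`-relation -/

/-- The principal two-sided ideal `M a M` of a monoid `M`. -/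
def principalIdeal {M : Type*} [Monoid M] (a : M) : Set M :=
  {x | ∃ p q : M, x = p * a * q}

/-- Green's preorder `a ≤_J b`: `M a M ⊆ M b M`. -/
def JLe {M : Type*} [Monoid M] (a b : M) : Prop :=
  principalIdeal a ⊆ principalIdeal b

/-- Green's relation `a J b`: `M a M = M b M`. -/
def JRel {M : Type*} [Monoid M] (a b : M) : Prop :=
  principalIdeal a = principalIdeal b

/-- A function with values in `ℕ` respects the `J`-order. -/
def RespectsJOrder {M : Type*} [Monoid M] (rank : M → ℕ) : Prop :=
  ∀ a b : M, JLe a b → rank a ≤ rank b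

/-- A function with values in `ℕ` is constant on `J`-classes. -/
def IsJClassInvariant {M : Type*} [Monoid M] (rank : M → ℕ) : Prop :=
  ∀ a b : M, JRel a b → rank a = rank b

/-! ### Gondran–Minoux independence and ranks -/

/-- Gondran–Minoux independence of a finite family of vectors: an equality between linear
combinations over disjoint index sets `I` and `J` forces all coefficients in it to be zero. -/
def GondranMinouxIndependent (S : Type*) [CommSemiring S] {ι V : Type*} [DecidableEq ι]
    [AddCommMonoid V] [Module S V] (x : ι → V) : Prop :=
  ∀ I J : Finset ι, Disjoint I J → ∀ α : ι → S,
    ∑ i ∈ I, α i • x i = ∑ j ∈ J, α j • x j → ∀ i ∈ I ∪ J, α i = 0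

open Classical in
/-- The maximal number of Gondran–Minoux independent columns of `A`. -/
noncomputable def maxGMColumnRank {S : Type*} [CommSemiring S] {n : ℕ}
    (A : Matrix (Fin n) (Fin n) S) : ℕ :=
  (Finset.univ.filter fun s : Finset (Fin n) =>
    GondranMinouxIndependent S fun j : s => A.col j).sup Finset.card

open Classical in
/-- The maximal number of Gondran–Minoux independent rows of `A`. -/
noncomputable def maxGMRowRank {S : Type*} [CommSemiring S] {n : ℕ}
    (A : Matrix (Fin n) (Fin n) S) : ℕ :=
  (Finset.univ.filter fun s : Finset (Fin n) =>
    GondranMinouxIndependent S fun i : s => A.row i).sup Finset.card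

/-!
The columns of `P * B * Q` are linear combinations of the columns of `P * B`, and a Gondran–Minoux
relation between columns of `B` is carried by `P` to one between the corresponding columns of
`P * B`. So the point is an exchange property: if Gondran–Minoux independent vectors lie in the
span of a family `v`, then they can be replaced, one at a time, by members of `v` without losing
independence (`GondranMinouxIndependent.exists_comp`). Rows follow by transposition.

Write a signed combination as a pair `(p, q)` of coefficient families with `p i = 0 ∨ q i = 0`.
If `x` is independent and replacing `x i₀` by `v k` makes it dependent for every `k`, then, after
scaling, every `v k` satisfies a relation `c • v k + ∑ p i • x i = ∑ q i • x i`, the sums being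
over `i ≠ i₀`. The vectors satisfying such a relation form a submodule (`gmClosure`), which
therefore contains `x i₀`, contradicting independence. Closure under addition is the heart of the
matter: the relations for `u` and `u'`, with coefficients `(p, q)` and `(p', q')`, combine as sign
vectors of an oriented matroid do, by keeping at each index the pair of larger absolute value and
preferring `(p, q)` in a tie. Preferring the same side at all ties makes the terms that attain the
maximum in a coordinate survive with their signs (`compose_relation`).

The constant `c` is `1` over `ℝ ∪ {-∞}`, where nonzero scalars are invertible. Over
`ℝ ∪ {-∞, +∞}` it is `+∞`: multiplying a relation by `+∞` turns all its nonzero coefficients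
into `+∞`. `MaxPlus.IsPivot` records what the argument uses of `c`.
-/

/-! ### The order of a max-plus semiring -/

namespace MaxPlus

variable {R : Type*} [LinearOrder R]

/-- The order transported from `R`; it is the one for which addition is `max`. -/
instance : LinearOrder (MaxPlus R) :=
  LinearOrder.lift' MaxPlus.val fun _ _ h => MaxPlus.ext h

theorem le_def {a b : MaxPlus R} : a ≤ b ↔ a.val ≤ b.val := Iff.rfl

theorem add_le_iff {a b m : MaxPlus R} : a + b ≤ m ↔ a ≤ m ∧ b ≤ m := max_le_iff

theorem le_add_left' (a b : MaxPlus R) : a ≤ a + b := le_max_left a.val b.val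

theorem le_add_right' (a b : MaxPlus R) : b ≤ a + b := le_max_right a.val b.val

theorem add_eq_or (a b : MaxPlus R) : a + b = a ∨ a + b = b :=
  (max_choice a.val b.val).imp MaxPlus.ext MaxPlus.ext

theorem zero_le' [OrderBot R] (a : MaxPlus R) : 0 ≤ a := le_def.2 bot_le

theorem mul_le_mul_right' [AddCommMonoid R] [IsOrderedAddMonoid R] {a b : MaxPlus R} (h : a ≤ b)
    (d : MaxPlus R) : a * d ≤ b * d :=
  le_def.2 (add_le_add_left (le_def.1 h) d.val)

variable [OrderBot R] [AddCommMonoid R] [IsOrderedAddMonoid R] [BotAbsorbing R] {ι : Type*}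

theorem sum_le_iff {s : Finset ι} {f : ι → MaxPlus R} {m : MaxPlus R} :
    ∑ i ∈ s, f i ≤ m ↔ ∀ i ∈ s, f i ≤ m := by
  classical
  induction s using Finset.induction_on with
  | empty => simp [zero_le']
  | insert a s ha ih => simp [Finset.sum_insert ha, add_le_iff, ih]

theorem le_sum {s : Finset ι} {f : ι → MaxPlus R} {i : ι} (hi : i ∈ s) :
    f i ≤ ∑ j ∈ s, f j :=
  sum_le_iff.1 le_rfl i hi

theorem exists_eq_sum {s : Finset ι} {f : ι → MaxPlus R} (h : ∑ i ∈ s, f i ≠ 0) :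
    ∃ i ∈ s, f i = ∑ j ∈ s, f j := by
  classical
  induction s using Finset.induction_on with
  | empty => simp at h
  | insert a s ha ih =>
    rw [Finset.sum_insert ha] at h ⊢
    rcases add_eq_or (f a) (∑ j ∈ s, f j) with e | e
    · exact ⟨a, Finset.mem_insert_self _ _, e.symm⟩
    · rw [e] at h ⊢
      obtain ⟨i, hi, hs⟩ := ih h
      exact ⟨i, Finset.mem_insert_of_mem hi, hs⟩

/-! ### Pivots -/

/-- A nonzero element `c` to which every nonzero coefficient of a relation can be scaled, such that
multiplication by a fixed element reflects the order on the multiples of `c`, as long as the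
larger product is nonzero. -/
structure IsPivot (c : MaxPlus R) : Prop where
  ne_zero : c ≠ 0
  exists_mul_eq : ∀ a : MaxPlus R, a ≠ 0 → ∃ d, c ∣ d ∧ d * a = c
  le_of_mul_le_mul : ∀ x y a : MaxPlus R, c ∣ x → c ∣ y → x * a ≠ 0 → y * a ≤ x * a → y ≤ x

end MaxPlus

theorem TropicalSemiring.isPivot_one : MaxPlus.IsPivot (1 : TropicalSemiring) where
  ne_zero h := WithBot.zero_ne_bot (α := ℝ) (congrArg MaxPlus.val h)
  exists_mul_eq := by
    rintro ⟨a⟩ ha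
    induction a using WithBot.recBotCoe with
    | bot => exact absurd rfl ha
    | coe r =>
      refine ⟨⟨((-r : ℝ) : WithBot ℝ)⟩, one_dvd _, MaxPlus.ext ?_⟩
      change ((-r : ℝ) : WithBot ℝ) + (r : WithBot ℝ) = 0
      rw [← WithBot.coe_add, neg_add_cancel, WithBot.coe_zero]
  le_of_mul_le_mul := by
    rintro ⟨x⟩ ⟨y⟩ ⟨a⟩ - - h0 h
    induction a using WithBot.recBotCoe with
    | bot => exact absurd (mul_zero (⟨x⟩ : TropicalSemiring)) h0
    | coe r => exact (WithBot.add_le_add_iff_right (WithBot.coe_ne_bot)).1 h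

theorem CompletedTropicalSemiring.isPivot_top :
    MaxPlus.IsPivot (⟨⊤⟩ : CompletedTropicalSemiring) where
  ne_zero h := top_ne_bot (α := EReal) (congrArg MaxPlus.val h)
  exists_mul_eq a ha :=
    ⟨⟨⊤⟩, dvd_rfl, MaxPlus.ext (EReal.top_add_of_ne_bot fun h => ha (MaxPlus.ext h))⟩
  le_of_mul_le_mul := by
    rintro _ y a ⟨t, rfl⟩ - h0 -
    have ht : t ≠ 0 := by
      rintro rfl
      exact h0 (by rw [mul_zero, zero_mul])
    have : (⟨⊤⟩ : CompletedTropicalSemiring) * t = ⟨⊤⟩ :=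
      MaxPlus.ext (EReal.top_add_of_ne_bot fun h => ht (MaxPlus.ext h))
    rw [this]
    exact MaxPlus.le_def.2 le_top

/-! ### Relations as pairs of coefficient families -/

theorem gondranMinouxIndependent_iff {S ι V : Type*} [CommSemiring S] [Fintype ι] [DecidableEq ι]
    [AddCommMonoid V] [Module S V] {x : ι → V} :
    GondranMinouxIndependent S x ↔ ∀ p q : ι → S, (∀ i, p i = 0 ∨ q i = 0) →
      ∑ i, p i • x i = ∑ i, q i • x i → ∀ i, p i = 0 ∧ q i = 0 := by
  classical
  constructor
  · intro h p q hpq e i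
    have hd : Disjoint (Finset.univ.filter fun i => p i ≠ 0)
        (Finset.univ.filter fun i => q i ≠ 0) := by
      refine Finset.disjoint_filter.2 fun i _ h1 h2 => ?_
      exact (hpq i).elim h1 h2
    have hsum : ∀ f : ι → S, (∀ i, f i ≠ 0 → p i + q i = f i) →
        ∑ i ∈ Finset.univ.filter (fun i => f i ≠ 0), (p i + q i) • x i = ∑ i, f i • x i := by
      intro f hf
      rw [Finset.sum_filter]
      refine Finset.sum_congr rfl fun i _ => ?_
      split_ifs with h0
      · rw [hf i h0]
      · rw [not_not.1 h0, zero_smul]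
    have key := h _ _ hd (fun i => p i + q i) (by
      rw [hsum p fun i h0 => by rw [(hpq i).resolve_left h0, add_zero],
        hsum q fun i h0 => by rw [(hpq i).resolve_right h0, zero_add], e]) i
    by_contra hne
    rw [not_and_or] at hne
    have h0 := key (by simpa using hne)
    rcases hpq i with hi | hi <;> simp_all
  · intro h I J hIJ α e i hi
    have key := h (fun i => if i ∈ I then α i else 0) (fun i => if i ∈ J then α i else 0)
      (fun i => by
        by_cases hI : i ∈ I
        · exact Or.inr (if_neg (Finset.disjoint_left.1 hIJ hI))
        · exact Or.inl (if_neg hI))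
      (by simpa [ite_smul] using e) i
    rcases Finset.mem_union.1 hi with hi | hi
    · simpa [hi] using key.1
    · simpa [hi] using key.2

section Closure

variable {R : Type*} [LinearOrder R] [OrderBot R] [AddCommMonoid R] [IsOrderedAddMonoid R]
  [BotAbsorbing R] {ι m κ : Type*}

/-- One coordinate of the composition of two relations: here `a i` is the coordinate of the `i`-th
vector, and `w`, `w'` are those of the two vectors on the left. -/
theorem compose_relation {c : MaxPlus R} (hc : MaxPlus.IsPivot c) {s : Finset ι}
    {p q p' q' a : ι → MaxPlus R} (hp : ∀ i, c ∣ p i) (hq : ∀ i, c ∣ q i) (hp' : ∀ i, c ∣ p' i)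
    (hq' : ∀ i, c ∣ q' i) {w w' : MaxPlus R}
    (e : w + ∑ i ∈ s, p i * a i = ∑ i ∈ s, q i * a i)
    (e' : w' + ∑ i ∈ s, p' i * a i = ∑ i ∈ s, q' i * a i) :
    (w + w') + ∑ i ∈ s, (if p' i + q' i ≤ p i + q i then p i else p' i) * a i =
      ∑ i ∈ s, (if p' i + q' i ≤ p i + q i then q i else q' i) * a i := by
  obtain ⟨M, hM⟩ : ∃ M, M = ∑ i ∈ s, q i * a i + ∑ i ∈ s, q' i * a i := ⟨_, rfl⟩
  have hQ : ∑ i ∈ s, q i * a i ≤ M := hM ▸ MaxPlus.le_add_left' _ _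
  have hQ' : ∑ i ∈ s, q' i * a i ≤ M := hM ▸ MaxPlus.le_add_right' _ _
  have hwP := MaxPlus.add_le_iff.1 e.le
  have hwP' := MaxPlus.add_le_iff.1 e'.le
  have bq := MaxPlus.sum_le_iff.1 hQ
  have bq' := MaxPlus.sum_le_iff.1 hQ'
  have bp := MaxPlus.sum_le_iff.1 (hwP.2.trans hQ)
  have bp' := MaxPlus.sum_le_iff.1 (hwP'.2.trans hQ')
  have bP : ∑ i ∈ s, (if p' i + q' i ≤ p i + q i then p i else p' i) * a i ≤ M := by
    refine MaxPlus.sum_le_iff.2 fun i hi => ?_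
    split_ifs
    exacts [bp i hi, bp' i hi]
  have bQ : ∑ i ∈ s, (if p' i + q' i ≤ p i + q i then q i else q' i) * a i ≤ M := by
    refine MaxPlus.sum_le_iff.2 fun i hi => ?_
    split_ifs
    exacts [bq i hi, bq' i hi]
  have bw : w + w' ≤ M := MaxPlus.add_le_iff.2 ⟨hwP.1.trans hQ, hwP'.1.trans hQ'⟩
  -- Both sides equal `M`: they are at most `M`, and it remains to find a term `M` in each.
  suffices h : M ≤ ∑ i ∈ s, (if p' i + q' i ≤ p i + q i then q i else q' i) * a i ∧
      (M ≤ w + w' ∨ M ≤ ∑ i ∈ s, (if p' i + q' i ≤ p i + q i then p i else p' i) * a i) by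
    rw [le_antisymm bQ h.1]
    refine le_antisymm (MaxPlus.add_le_iff.2 ⟨bw, bP⟩) ?_
    exact h.2.elim (fun h => h.trans (MaxPlus.le_add_left' _ _))
      fun h => h.trans (MaxPlus.le_add_right' _ _)
  rcases eq_or_ne M 0 with h0 | h0
  · rw [h0]
    exact ⟨MaxPlus.zero_le' _, Or.inl (MaxPlus.zero_le' _)⟩
  rcases eq_or_lt_of_le hQ with hQM | hQM
  · -- The terms of the first relation that attain `M` have the larger absolute value.
    have keep : ∀ (i) (_ : i ∈ s) (b : MaxPlus R), c ∣ b → b * a i = M → b ≤ p i + q i →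
        p' i + q' i ≤ p i + q i := fun i hi b hb hbM hle =>
      (MaxPlus.add_le_iff.2
        ⟨hc.le_of_mul_le_mul _ _ _ hb (hp' i) (hbM.trans_ne h0) ((bp' i hi).trans hbM.ge),
          hc.le_of_mul_le_mul _ _ _ hb (hq' i) (hbM.trans_ne h0)
            ((bq' i hi).trans hbM.ge)⟩).trans hle
    constructor
    · obtain ⟨i, hi, hiM⟩ := MaxPlus.exists_eq_sum (hQM.trans_ne h0)
      rw [hQM] at hiM
      have := MaxPlus.le_sum (f := fun i =>
        (if p' i + q' i ≤ p i + q i then q i else q' i) * a i) hi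
      simp only [if_pos (keep i hi _ (hq i) hiM (MaxPlus.le_add_right' _ _)), hiM] at this
      exact this
    · rcases MaxPlus.add_eq_or w (∑ i ∈ s, p i * a i) with h | h
      · left
        rw [← hQM, ← e, h]
        exact MaxPlus.le_add_left' _ _
      · right
        rw [e, hQM] at h
        obtain ⟨i, hi, hiM⟩ := MaxPlus.exists_eq_sum (h.symm.trans_ne h0)
        rw [← h] at hiM
        have := MaxPlus.le_sum (f := fun i =>
          (if p' i + q' i ≤ p i + q i then p i else p' i) * a i) hi
        simp only [if_pos (keep i hi _ (hp i) hiM (MaxPlus.le_add_left' _ _)), hiM] at this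
        exact this
  · -- The first relation stays strictly below `M`, so terms equal to `M` come from the second.
    have hQM' : ∑ i ∈ s, q' i * a i = M := by
      rcases MaxPlus.add_eq_or (∑ i ∈ s, q i * a i) (∑ i ∈ s, q' i * a i) with h | h
      · exact absurd (hM.trans h) hQM.ne'
      · exact (hM.trans h).symm
    have drop : ∀ (i) (_ : i ∈ s) (b : MaxPlus R), b * a i = M → b ≤ p' i + q' i →
        ¬ p' i + q' i ≤ p i + q i := fun i hi b hbM hle hcon => by
      have h1 := MaxPlus.mul_le_mul_right' (hle.trans hcon) (a i)
      rw [hbM, add_mul] at h1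
      exact absurd (h1.trans (MaxPlus.add_le_iff.2
        ⟨(MaxPlus.le_sum (f := fun i => p i * a i) hi).trans hwP.2,
          MaxPlus.le_sum (f := fun i => q i * a i) hi⟩)) hQM.not_ge
    constructor
    · obtain ⟨i, hi, hiM⟩ := MaxPlus.exists_eq_sum (hQM'.trans_ne h0)
      rw [hQM'] at hiM
      have := MaxPlus.le_sum (f := fun i =>
        (if p' i + q' i ≤ p i + q i then q i else q' i) * a i) hi
      simp only [if_neg (drop i hi _ hiM (MaxPlus.le_add_right' _ _)), hiM] at this
      exact this
    · rcases MaxPlus.add_eq_or w' (∑ i ∈ s, p' i * a i) with h | h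
      · left
        rw [← hQM', ← e', h]
        exact MaxPlus.le_add_right' _ _
      · right
        rw [e', hQM'] at h
        obtain ⟨i, hi, hiM⟩ := MaxPlus.exists_eq_sum (h.symm.trans_ne h0)
        rw [← h] at hiM
        have := MaxPlus.le_sum (f := fun i =>
          (if p' i + q' i ≤ p i + q i then p i else p' i) * a i) hi
        simp only [if_neg (drop i hi _ hiM (MaxPlus.le_add_left' _ _)), hiM] at this
        exact this

/-! ### The exchange property -/

/-- The vectors that depend, with coefficient `c`, on the vectors `x i` for `i ∈ s`. The remaining
coefficients are required to be multiples of `c`, so that the order is reflected as in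
`MaxPlus.IsPivot.le_of_mul_le_mul`. -/
def gmClosure {c : MaxPlus R} (hc : MaxPlus.IsPivot c) (x : ι → m → MaxPlus R) (s : Finset ι) :
    Submodule (MaxPlus R) (m → MaxPlus R) where
  carrier := {u | ∃ p q : ι → MaxPlus R, (∀ i, c ∣ p i) ∧ (∀ i, c ∣ q i) ∧
    (∀ i, p i = 0 ∨ q i = 0) ∧ c • u + ∑ i ∈ s, p i • x i = ∑ i ∈ s, q i • x i}
  zero_mem' := ⟨0, 0, fun _ => dvd_zero c, fun _ => dvd_zero c, fun _ => Or.inl rfl, by simp⟩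
  add_mem' := by
    rintro u u' ⟨p, q, hp, hq, hpq, e⟩ ⟨p', q', hp', hq', hpq', e'⟩
    refine ⟨fun i => if p' i + q' i ≤ p i + q i then p i else p' i,
      fun i => if p' i + q' i ≤ p i + q i then q i else q' i, fun i => ?_, fun i => ?_,
      fun i => ?_, funext fun r => ?_⟩
    · dsimp only
      split_ifs
      exacts [hp i, hp' i]
    · dsimp only
      split_ifs
      exacts [hq i, hq' i]
    · dsimp only
      split_ifs
      exacts [hpq i, hpq' i]
    · have er := congrFun e r
      have er' := congrFun e' r
      simp only [Pi.add_apply, Pi.smul_apply, Finset.sum_apply, smul_eq_mul] at er er' ⊢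
      rw [mul_add]
      exact compose_relation hc hp hq hp' hq' er er'
  smul_mem' := by
    rintro d u ⟨p, q, hp, hq, hpq, e⟩
    refine ⟨fun i => d * p i, fun i => d * q i, fun i => (hp i).mul_left d,
      fun i => (hq i).mul_left d, fun i => ?_, ?_⟩
    · exact (hpq i).imp (mul_eq_zero_of_right d) (mul_eq_zero_of_right d)
    · simp only [mul_smul, ← Finset.smul_sum]
      rw [← e, smul_add, smul_comm]

theorem sum_update_smul_update {S V : Type*} [CommSemiring S] [AddCommMonoid V] [Module S V]
    [Fintype ι] [DecidableEq ι] (p : ι → S) (x : ι → V) (i₀ : ι) (b : S) (u : V) :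
    ∑ i, Function.update p i₀ b i • Function.update x i₀ u i =
      b • u + ∑ i ∈ Finset.univ.erase i₀, p i • x i := by
  rw [← Finset.add_sum_erase _ _ (Finset.mem_univ i₀)]
  congr 1
  · simp
  · refine Finset.sum_congr rfl fun i hi => ?_
    simp [Finset.ne_of_mem_erase hi]

variable [Fintype ι] [DecidableEq ι] {c : MaxPlus R}

theorem not_gondranMinouxIndependent_of_mem_gmClosure (hc : MaxPlus.IsPivot c)
    {x : ι → m → MaxPlus R} {i₀ : ι} (h : x i₀ ∈ gmClosure hc x (Finset.univ.erase i₀)) :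
    ¬ GondranMinouxIndependent (MaxPlus R) x := by
  obtain ⟨p, q, -, -, hpq, e⟩ := h
  intro hx
  have := gondranMinouxIndependent_iff.1 hx (Function.update p i₀ c) (Function.update q i₀ 0)
    (fun i => by
      rcases eq_or_ne i i₀ with rfl | hi
      · simp
      · simpa [hi] using hpq i)
    (by
      have hs := sum_update_smul_update p x i₀ c (x i₀)
      have hs' := sum_update_smul_update q x i₀ 0 (x i₀)
      rw [Function.update_eq_self] at hs hs'
      rw [hs, hs', e, zero_smul, zero_add]) i₀
  exact hc.ne_zero (by simpa using this.1)

theorem mem_gmClosure_of_not_gondranMinouxIndependent (hc : MaxPlus.IsPivot c)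
    {x : ι → m → MaxPlus R} (hx : GondranMinouxIndependent (MaxPlus R) x) {i₀ : ι}
    {u : m → MaxPlus R} (h : ¬ GondranMinouxIndependent (MaxPlus R) (Function.update x i₀ u)) :
    u ∈ gmClosure hc x (Finset.univ.erase i₀) := by
  have key : ∀ p q : ι → MaxPlus R, (∀ i, p i = 0 ∨ q i = 0) → p i₀ ≠ 0 →
      ∑ i, p i • Function.update x i₀ u i = ∑ i, q i • Function.update x i₀ u i →
      u ∈ gmClosure hc x (Finset.univ.erase i₀) := by
    intro p q hpq hp0 e
    obtain ⟨d, hd, hdc⟩ := hc.exists_mul_eq _ hp0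
    refine ⟨fun i => d * p i, fun i => d * q i, fun i => hd.mul_right _, fun i => hd.mul_right _,
      fun i => (hpq i).imp (mul_eq_zero_of_right d) (mul_eq_zero_of_right d), ?_⟩
    have hs := sum_update_smul_update p x i₀ (p i₀) u
    have hs' := sum_update_smul_update q x i₀ (q i₀) u
    rw [Function.update_eq_self] at hs hs'
    rw [hs, hs', (hpq i₀).resolve_left hp0, zero_smul, zero_add] at e
    simp only [mul_smul, ← Finset.smul_sum]
    rw [← e, smul_add, ← mul_smul, hdc]
  rw [gondranMinouxIndependent_iff] at h
  push Not at h
  obtain ⟨p, q, hpq, e, i, hi⟩ := h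
  by_cases hp0 : p i₀ = 0
  · by_cases hq0 : q i₀ = 0
    · -- The relation does not involve `u`, so it is one between the vectors `x i`.
      exfalso
      have hs : ∀ f : ι → MaxPlus R, f i₀ = 0 →
          ∑ i, f i • Function.update x i₀ u i = ∑ i, f i • x i := by
        intro f hf
        refine Finset.sum_congr rfl fun i _ => ?_
        rcases eq_or_ne i i₀ with rfl | hi
        · rw [hf, zero_smul, zero_smul]
        · rw [Function.update_of_ne hi]
      rw [hs p hp0, hs q hq0] at e
      have := gondranMinouxIndependent_iff.1 hx p q hpq e i
      exact hi this.1 this.2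
    · exact key q p (fun i => (hpq i).symm) hq0 e.symm
  · exact key p q hpq hp0 e

theorem GondranMinouxIndependent.exists_update (hc : MaxPlus.IsPivot c)
    {x : ι → m → MaxPlus R} (hx : GondranMinouxIndependent (MaxPlus R) x) {v : κ → m → MaxPlus R}
    {i₀ : ι} (hv : x i₀ ∈ Submodule.span (MaxPlus R) (Set.range v)) :
    ∃ k, GondranMinouxIndependent (MaxPlus R) (Function.update x i₀ (v k)) := by
  by_contra! h
  refine not_gondranMinouxIndependent_of_mem_gmClosure hc (Submodule.span_le.2 ?_ hv) hx
  rintro _ ⟨k, rfl⟩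
  exact mem_gmClosure_of_not_gondranMinouxIndependent hc hx (h k)

/-- Independent vectors in the span of `v` can be replaced by members of `v`. -/
theorem GondranMinouxIndependent.exists_comp (hc : MaxPlus.IsPivot c)
    {x : ι → m → MaxPlus R} (hx : GondranMinouxIndependent (MaxPlus R) x) {v : κ → m → MaxPlus R}
    (hv : ∀ i, x i ∈ Submodule.span (MaxPlus R) (Set.range v)) :
    ∃ f : ι → κ, GondranMinouxIndependent (MaxPlus R) (v ∘ f) := by
  suffices h : ∀ t : Finset ι, ∃ y : ι → m → MaxPlus R, GondranMinouxIndependent (MaxPlus R) y ∧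
      (∀ i ∈ t, y i ∈ Set.range v) ∧ ∀ i ∉ t, y i = x i by
    obtain ⟨y, hy, hyv, -⟩ := h Finset.univ
    choose f hf using fun i => hyv i (Finset.mem_univ i)
    exact ⟨f, by rwa [show v ∘ f = y from funext hf]⟩
  intro t
  induction t using Finset.induction_on with
  | empty => exact ⟨x, hx, by simp, fun _ _ => rfl⟩
  | insert i₀ t hi₀ ih =>
    obtain ⟨y, hy, hyt, hyx⟩ := ih
    obtain ⟨k, hk⟩ := hy.exists_update hc (v := v) (i₀ := i₀) (hyx i₀ hi₀ ▸ hv i₀)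
    refine ⟨_, hk, fun i hi => ?_, fun i hi => ?_⟩
    · rcases eq_or_ne i i₀ with rfl | hne
      · simp
      · rw [Function.update_of_ne hne]
        exact hyt i (Finset.mem_of_mem_insert_of_ne hi hne)
    · rw [Finset.mem_insert, not_or] at hi
      rw [Function.update_of_ne hi.1, hyx i hi.2]

end Closure

/-! ### Ranks and matrix multiplication -/

theorem GondranMinouxIndependent.of_map {S ι V W : Type*} [CommSemiring S] [Fintype ι]
    [DecidableEq ι] [AddCommMonoid V] [Module S V] [AddCommMonoid W] [Module S W] {x : ι → V}
    (g : V →ₗ[S] W) (h : GondranMinouxIndependent S (g ∘ x)) : GondranMinouxIndependent S x := by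
  intro I J hIJ α e
  refine h I J hIJ α ?_
  simpa [map_sum] using congrArg g e

theorem GondranMinouxIndependent.injective {S ι V : Type*} [CommSemiring S] [Nontrivial S]
    [DecidableEq ι] [AddCommMonoid V] [Module S V] {x : ι → V}
    (h : GondranMinouxIndependent S x) : Function.Injective x := by
  intro i j hij
  by_contra hne
  exact one_ne_zero (h {i} {j} (by simpa using hne) (fun _ => 1) (by simpa using hij) i (by simp))

section Rank

variable {S : Type*} [CommSemiring S] {n : ℕ}

theorem card_le_maxGMColumnRank [Nontrivial S] {ι : Type*} [Fintype ι] [DecidableEq ι]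
    {A : Matrix (Fin n) (Fin n) S} {f : ι → Fin n}
    (h : GondranMinouxIndependent S fun i => A.col (f i)) :
    Fintype.card ι ≤ maxGMColumnRank A := by
  classical
  have hf : Function.Injective f := fun i j hij => h.injective (congrArg A.col hij)
  rw [← Finset.card_univ, ← Finset.card_image_of_injective _ hf]
  refine Finset.le_sup (f := Finset.card) (Finset.mem_filter.2 ⟨Finset.mem_univ _, ?_⟩)
  rw [gondranMinouxIndependent_iff] at h ⊢
  let g : ι ≃ ↥(Finset.univ.image f) := Equiv.ofBijective (fun i => ⟨f i, by simp⟩)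
    ⟨fun i j hij => hf (congrArg Subtype.val hij), fun ⟨k, hk⟩ => by
      obtain ⟨i, -, rfl⟩ := Finset.mem_image.1 hk
      exact ⟨i, rfl⟩⟩
  intro p q hpq e j
  rw [← g.sum_comp, ← g.sum_comp] at e
  simpa using h (p ∘ g) (q ∘ g) (fun i => hpq (g i)) e (g.symm j)

theorem exists_card_eq_maxGMColumnRank (A : Matrix (Fin n) (Fin n) S) :
    ∃ s : Finset (Fin n), s.card = maxGMColumnRank A ∧
      GondranMinouxIndependent S fun j : s => A.col j := by
  classical
  have hne : (Finset.univ.filter fun s : Finset (Fin n) =>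
      GondranMinouxIndependent S fun j : s => A.col j).Nonempty := by
    refine ⟨∅, Finset.mem_filter.2 ⟨Finset.mem_univ _, ?_⟩⟩
    intro I J _ α _ i
    exact absurd i.2 (Finset.notMem_empty _)
  obtain ⟨s, hs, e⟩ := Finset.exists_mem_eq_sup _ hne Finset.card
  exact ⟨s, by unfold maxGMColumnRank; convert e.symm, (Finset.mem_filter.1 hs).2⟩

theorem maxGMRowRank_eq_maxGMColumnRank_transpose (A : Matrix (Fin n) (Fin n) S) :
    maxGMRowRank A = maxGMColumnRank A.transpose :=
  rfl

theorem JLe.exists_eq {M : Type*} [Monoid M] {a b : M} (h : JLe a b) : ∃ p q, a = p * b * q :=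
  h ⟨1, 1, by simp⟩

theorem RespectsJOrder.isJClassInvariant {M : Type*} [Monoid M] {rank : M → ℕ}
    (h : RespectsJOrder rank) : IsJClassInvariant rank := fun a b hab =>
  le_antisymm (h a b (Eq.subset hab)) (h b a (Eq.superset hab))

end Rank

section Main

variable {R : Type*} [LinearOrder R] [OrderBot R] [AddCommMonoid R] [IsOrderedAddMonoid R]
  [BotAbsorbing R] {c : MaxPlus R} {n : ℕ}

theorem maxGMColumnRank_mul_mul_le (hc : MaxPlus.IsPivot c)
    (P B Q : Matrix (Fin n) (Fin n) (MaxPlus R)) :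
    maxGMColumnRank (P * B * Q) ≤ maxGMColumnRank B := by
  have : Nontrivial (MaxPlus R) := ⟨c, 0, hc.ne_zero⟩
  obtain ⟨s, hs, hind⟩ := exists_card_eq_maxGMColumnRank (P * B * Q)
  obtain ⟨f, hf⟩ := hind.exists_comp hc (v := (P * B).col) fun j => by
    have : (P * B * Q).col j = ∑ k, Q k j • (P * B).col k := by
      ext r
      simp [Matrix.mul_apply (M := P * B), mul_comm]
    rw [this]
    exact Submodule.sum_mem _ fun k _ =>
      Submodule.smul_mem _ _ (Submodule.subset_span (Set.mem_range_self k))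
  have hB : GondranMinouxIndependent (MaxPlus R) fun j => B.col (f j) := by
    refine GondranMinouxIndependent.of_map P.mulVecLin ?_
    exact hf
  calc maxGMColumnRank (P * B * Q) = Fintype.card s := by rw [← hs, Fintype.card_coe]
    _ ≤ maxGMColumnRank B := card_le_maxGMColumnRank hB

theorem respectsJOrder_maxGMColumnRank (hc : MaxPlus.IsPivot c) :
    RespectsJOrder (maxGMColumnRank : Matrix (Fin n) (Fin n) (MaxPlus R) → ℕ) := by
  intro A B h
  obtain ⟨P, Q, rfl⟩ := h.exists_eq
  exact maxGMColumnRank_mul_mul_le hc P B Q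

theorem respectsJOrder_maxGMRowRank (hc : MaxPlus.IsPivot c) :
    RespectsJOrder (maxGMRowRank : Matrix (Fin n) (Fin n) (MaxPlus R) → ℕ) := by
  intro A B h
  obtain ⟨P, Q, rfl⟩ := h.exists_eq
  rw [maxGMRowRank_eq_maxGMColumnRank_transpose, maxGMRowRank_eq_maxGMColumnRank_transpose,
    Matrix.transpose_mul, Matrix.transpose_mul, ← Matrix.mul_assoc]
  exact maxGMColumnRank_mul_mul_le hc _ _ _

end Main

theorem mainTheorem10 (n : ℕ) :
    ((RespectsJOrder
          (maxGMColumnRank : Matrix (Fin n) (Fin n) TropicalSemiring → ℕ) ∧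
        RespectsJOrder
          (maxGMRowRank : Matrix (Fin n) (Fin n) TropicalSemiring → ℕ)) ∧
      (IsJClassInvariant
          (maxGMColumnRank : Matrix (Fin n) (Fin n) TropicalSemiring → ℕ) ∧
        IsJClassInvariant
          (maxGMRowRank : Matrix (Fin n) (Fin n) TropicalSemiring → ℕ))) ∧
    ((RespectsJOrder
          (maxGMColumnRank : Matrix (Fin n) (Fin n) CompletedTropicalSemiring → ℕ) ∧
        RespectsJOrder
          (maxGMRowRank : Matrix (Fin n) (Fin n) CompletedTropicalSemiring → ℕ)) ∧
      (IsJClassInvariant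
          (maxGMColumnRank : Matrix (Fin n) (Fin n) CompletedTropicalSemiring → ℕ) ∧
        IsJClassInvariant
          (maxGMRowRank : Matrix (Fin n) (Fin n) CompletedTropicalSemiring → ℕ))) := by
  have hT := TropicalSemiring.isPivot_one
  have hC := CompletedTropicalSemiring.isPivot_top
  exact ⟨⟨⟨respectsJOrder_maxGMColumnRank hT, respectsJOrder_maxGMRowRank hT⟩,
      (respectsJOrder_maxGMColumnRank hT).isJClassInvariant,
      (respectsJOrder_maxGMRowRank hT).isJClassInvariant⟩,
    ⟨respectsJOrder_maxGMColumnRank hC, respectsJOrder_maxGMRowRank hC⟩,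
    (respectsJOrder_maxGMColumnRank hC).isJClassInvariant,
    (respectsJOrder_maxGMRowRank hC).isJClassInvariant⟩
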